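/- Let $\nu\ge 0$ be an integer and let $\rho\in[-1,1]$. Let $X_t=(x_{t1},x_{t2})$, $t=1,\dots,\nu$, be independent random vectors, each normally distributed with mean $0$ and covariance matrix $\begin{pmatrix}1&\rho\\ \rho&1\end{pmatrix}$, so that $W=(w_{ij})_{1\le i,j\le 2}$ with $w_{ij}=\sum_{t=1}^{\nu}x_{ti}x_{tj}$ has the central Wishart distribution $W_2\bigl(\nu,\begin{pmatrix}1&\rho\\ \rho&1\end{pmatrix}\bigr)$. The distribution of its diagonal $(w_{11},w_{22})$ is Kibble's bivariate chi-square distribution. For any random vector $(w_{11},w_{22})$ with this distribution and all integers $b,c\ge 0$, the moment $E[w_{11}^b w_{22}^c]$ exists (the variable $w_{11}^b w_{22}^c$ is integrable) and $$ E[w_{11}^b w_{22}^c]=\sum_{a=0}^{\min(b,c)}\rho^{2a}\,\frac{2^a\,b!\,c!}{(b-a)!\,(c-a)!\,a!}\,\prod_{i=1}^{a}\bigl(\nu+2(a-i)\bigr)\prod_{i=1}^{b-a}\bigl(\nu+2(b-i)\bigr)\prod_{i=1}^{c-a}\bigl(\nu+2(c-i)\bigr), $$ where empty products are equal to $1$.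 -/

import Mathlib

open MeasureTheory ProbabilityTheory Matrix
open scoped Nat

/-- The entrywise (product, equivalently Borel) σ-algebra on real matrices. -/
instance matrixMeasurableSpace {m n : ℕ} : MeasurableSpace (Matrix (Fin m) (Fin n) ℝ) :=
  inferInstanceAs (MeasurableSpace (Fin m → Fin n → ℝ))

/-- The scatter matrix `(∑ₜ xₜᵢ xₜⱼ)ᵢⱼ` of the vectors `x₁, …, x_ν` in `ℝᵖ`. -/
def scatterMatrix {p ν : ℕ} (x : Fin ν → EuclideanSpace ℝ (Fin p)) :
    Matrix (Fin p) (Fin p) ℝ :=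
  Matrix.of fun i j => ∑ t, x t i * x t j

theorem measurable_scatterMatrix {p ν : ℕ} :
    Measurable (scatterMatrix : (Fin ν → EuclideanSpace ℝ (Fin p)) → _) := by
  refine measurable_pi_lambda _ fun i => measurable_pi_lambda _ fun j => ?_
  simp only [scatterMatrix, Matrix.of_apply]
  fun_prop

/-- The (real, central) Wishart distribution `W_p(ν, S)`: the law of `(∑ₜ xₜᵢ xₜⱼ)ᵢⱼ`, where
`X₁, …, X_ν` are independent `N_p(0, S)` random vectors and `Xₜ = (xₜᵢ)ᵢ`. -/
noncomputable def wishart (p ν : ℕ) (S : Matrix (Fin p) (Fin p) ℝ) :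
    Measure (Matrix (Fin p) (Fin p) ℝ) :=
  (Measure.pi fun _ : Fin ν => multivariateGaussian (0 : EuclideanSpace ℝ (Fin p)) S).map
    scatterMatrix

/-- Kibble's bivariate chi-square distribution with parameters `ν` and `ρ`: the law of the diagonal
`(w₁₁, w₂₂)` of a `2 × 2` Wishart matrix `W ∼ W₂(ν, [[1, ρ], [ρ, 1]])`. -/
noncomputable def kibble (ν : ℕ) (ρ : ℝ) : Measure (ℝ × ℝ) :=
  (wishart 2 ν !![1, ρ; ρ, 1]).map fun W => (W 0 0, W 1 1)

/-! Write `W` through vectors `R z_t` with `R * Rᵀ` the covariance matrix and `z` an array of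
independent standard normals. Then `U = |x|²`, `V = |y|²` and `T = ⟨x, y⟩` are polynomials in `z`,
and Gaussian integration by parts reads `E[x_t p] = E[D_t p]`, where the derivation `D_t` sends
`x_t` to `1` and `y_t` to `ρ`. Applied to one factor `x_t` of `U` or of `T`, it gives a coupled
recursion for `M b c = E[U^b V^c]` and `N b c = E[T U^b V^c]` (`map_normSq_pow_succ_mul`,
`map_inner_mul_normSq_pow`). The recursion determines both families, and closed forms satisfy it by
binomial identities (`eq_normSqMoment_of_recursion`). -/

/-! ### Closed forms and their recursion -/

/-- The closed form of the moments `E[|x|^{2b} |y|^{2c}]`, where the `n` pairs `(xₜ, yₜ)` are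
independent standard normal pairs with correlation `ρ`. -/
noncomputable def normSqMoment (n ρ : ℝ) (b c : ℕ) : ℝ :=
  (∏ j ∈ Finset.range b, (n + 2 * j)) *
    ∑ a ∈ Finset.range (c + 1), (2 * ρ ^ 2) ^ a * (a ! : ℝ) * (b.choose a : ℝ) * (c.choose a : ℝ) *
      ∏ j ∈ Finset.Ico a c, (n + 2 * j)

/-- The closed form of the moments `E[⟨x, y⟩ |x|^{2b} |y|^{2c}]`, where the `n` pairs `(xₜ, yₜ)` are
independent standard normal pairs with correlation `ρ`. -/
noncomputable def innerNormSqMoment (n ρ : ℝ) (b c : ℕ) : ℝ :=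
  ρ * (∏ j ∈ Finset.range (b + 1), (n + 2 * j)) *
    ∑ a ∈ Finset.range (c + 1), (2 * ρ ^ 2) ^ a * (a ! : ℝ) * (b.choose a : ℝ) * (c.choose a : ℝ) *
      ∏ j ∈ Finset.Ico (a + 1) (c + 1), (n + 2 * j)

theorem normSqMoment_zero_left (n ρ : ℝ) (c : ℕ) :
    normSqMoment n ρ 0 c = ∏ j ∈ Finset.range c, (n + 2 * j) := by
  simp [normSqMoment, Finset.sum_range_succ']

theorem normSqMoment_succ_zero (n ρ : ℝ) (b : ℕ) :
    normSqMoment n ρ (b + 1) 0 = (n + 2 * b) * normSqMoment n ρ b 0 := by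
  simp [normSqMoment, Finset.prod_range_succ, mul_comm]

/-- Pascal's rule splits `(b + 1).choose (a + 1)`; in the second part `(a + 1) * (c + 1).choose (a +
1) = (c + 1) * c.choose a` produces the inner moment. -/
theorem normSqMoment_succ_succ (n ρ : ℝ) (b c : ℕ) :
    normSqMoment n ρ (b + 1) (c + 1) =
      (n + 2 * b) * normSqMoment n ρ b (c + 1) +
        2 * (c + 1) * ρ * innerNormSqMoment n ρ b c := by
  simp only [normSqMoment, innerNormSqMoment, Finset.sum_range_succ' _ (c + 1),
    Finset.prod_range_succ _ b]
  have h (a : ℕ) : ((a + 1)! : ℝ) * ((b + 1).choose (a + 1)) * ((c + 1).choose (a + 1)) =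
      (a + 1)! * (b.choose (a + 1)) * ((c + 1).choose (a + 1)) +
        (c + 1) * (a ! * b.choose a * c.choose a) := by
    have h₁ : ((c : ℝ) + 1) * c.choose a = (c + 1).choose (a + 1) * (a + 1) := by
      exact_mod_cast Nat.add_one_mul_choose_eq c a
    rw [Nat.choose_succ_succ b a, Nat.factorial_succ]
    push_cast
    linear_combination -(a ! : ℝ) * b.choose a * h₁
  have h' (a : ℕ) : (2 * ρ ^ 2) ^ (a + 1) * ((a + 1)! : ℝ) * ((b + 1).choose (a + 1)) *
      ((c + 1).choose (a + 1)) * ∏ j ∈ Finset.Ico (a + 1) (c + 1), (n + 2 * (j : ℝ)) =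
      (2 * ρ ^ 2) ^ (a + 1) * ((a + 1)! : ℝ) * (b.choose (a + 1)) *
      ((c + 1).choose (a + 1)) * ∏ j ∈ Finset.Ico (a + 1) (c + 1), (n + 2 * (j : ℝ)) +
      2 * (c + 1) * ρ ^ 2 * ((2 * ρ ^ 2) ^ a * (a ! : ℝ) * (b.choose a : ℝ) * (c.choose a : ℝ) *
        ∏ j ∈ Finset.Ico (a + 1) (c + 1), (n + 2 * (j : ℝ))) := by
    linear_combination (2 * ρ ^ 2) ^ (a + 1) * (∏ j ∈ Finset.Ico (a + 1) (c + 1), (n + 2 * (j : ℝ)))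
      * h a
  simp only [h', Finset.sum_add_distrib, ← Finset.mul_sum]
  simp only [Nat.choose_zero_right]
  ring

theorem innerNormSqMoment_zero_left (n ρ : ℝ) (c : ℕ) :
    innerNormSqMoment n ρ 0 c = ρ * (n + 2 * c) * normSqMoment n ρ 0 c := by
  rw [normSqMoment_zero_left]
  have h : (∏ j ∈ Finset.range (0 + 1), (n + 2 * (j : ℝ))) *
      ∏ j ∈ Finset.Ico (0 + 1) (c + 1), (n + 2 * (j : ℝ)) =
      (∏ j ∈ Finset.range c, (n + 2 * (j : ℝ))) * (n + 2 * c) := by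
    rw [Finset.prod_range_mul_prod_Ico _ (by lia), Finset.prod_range_succ]
  simp only [innerNormSqMoment, Finset.sum_range_succ', Nat.choose_zero_succ, Nat.choose_self,
    Nat.choose_zero_right, Nat.cast_zero, Nat.cast_one, mul_zero, zero_mul, mul_one,
    Finset.sum_const_zero, zero_add, pow_zero, Nat.factorial_zero] at h ⊢
  linear_combination ρ * h

/-- Termwise, split `n + 2(b+1)` as `2(b+1-a) + (n+2a)`: the first part lowers `b + 1` in the
binomial, the second shifts the product down to `Ico a c`. -/
theorem innerNormSqMoment_succ (n ρ : ℝ) (b c : ℕ) :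
    innerNormSqMoment n ρ (b + 1) c =
      2 * (b + 1) * innerNormSqMoment n ρ b c + ρ * (n + 2 * c) * normSqMoment n ρ (b + 1) c := by
  have h (a : ℕ) (ha : a ∈ Finset.range (c + 1)) :
      (n + 2 * (b + 1)) * ((2 * ρ ^ 2) ^ a * (a ! : ℝ) * ((b + 1).choose a : ℝ) *
        (c.choose a : ℝ) * ∏ j ∈ Finset.Ico (a + 1) (c + 1), (n + 2 * (j : ℝ))) =
      2 * (b + 1) * ((2 * ρ ^ 2) ^ a * (a ! : ℝ) * (b.choose a : ℝ) *
        (c.choose a : ℝ) * ∏ j ∈ Finset.Ico (a + 1) (c + 1), (n + 2 * (j : ℝ))) +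
      (n + 2 * c) * ((2 * ρ ^ 2) ^ a * (a ! : ℝ) * ((b + 1).choose a : ℝ) *
        (c.choose a : ℝ) * ∏ j ∈ Finset.Ico a c, (n + 2 * (j : ℝ))) := by
    have hac : a ≤ c := by simpa [Nat.lt_succ_iff] using ha
    have h₁ : (n + 2 * a) * ∏ j ∈ Finset.Ico (a + 1) (c + 1), (n + 2 * (j : ℝ)) =
        (∏ j ∈ Finset.Ico a c, (n + 2 * (j : ℝ))) * (n + 2 * c) := by
      rw [← Finset.prod_Ico_succ_top hac, Finset.prod_eq_prod_Ico_succ_bot (show a < c + 1 by lia)]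
    have h₂ : ((b : ℝ) + 1) * b.choose a = (b + 1).choose a * (b + 1 - a) := by
      rcases le_or_gt a (b + 1) with hab | hab
      · have := Nat.add_one_mul_choose_eq b a
        have h₃ := Nat.choose_succ_right_eq (b + 1) a
        rw [← this] at h₃
        have h₄ : (((b + 1 - a : ℕ) : ℕ) : ℝ) = b + 1 - a := by push_cast [hab]; ring
        rw [← h₄]
        exact_mod_cast h₃
      · simp [Nat.choose_eq_zero_of_lt hab, Nat.choose_eq_zero_of_lt (show b < a by lia)]
    linear_combination (2 * ρ ^ 2) ^ a * (a ! : ℝ) * (c.choose a : ℝ) * ((b + 1).choose a * h₁ -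
      2 * (∏ j ∈ Finset.Ico (a + 1) (c + 1), (n + 2 * (j : ℝ))) * h₂)
  have hs := Finset.sum_congr rfl h
  simp only [Finset.sum_add_distrib, ← Finset.mul_sum] at hs
  simp only [innerNormSqMoment, normSqMoment, Finset.prod_range_succ _ (b + 1)]
  push_cast
  linear_combination ρ * (∏ j ∈ Finset.range (b + 1), (n + 2 * (j : ℝ))) * hs

/-- The recursion obtained by Gaussian integration by parts determines the moments. -/
theorem eq_normSqMoment_of_recursion {n ρ : ℝ} {M N : ℕ → ℕ → ℝ} (h₀ : M 0 0 = 1)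
    (hM₀ : ∀ c, M 0 (c + 1) = (n + 2 * c) * M 0 c)
    (hM : ∀ b c, M (b + 1) c = (n + 2 * b) * M b c + 2 * c * ρ * N b (c - 1))
    (hN : ∀ b c, N b c = 2 * b * N (b - 1) c + ρ * (n + 2 * c) * M b c) (b c : ℕ) :
    M b c = normSqMoment n ρ b c ∧ N b c = innerNormSqMoment n ρ b c := by
  -- `M (b+1)` needs only `M b` and `N b`; then `N (b+1)` needs `N b` and `M (b+1)`. Truncated
  -- indices carry a zero coefficient.
  induction b generalizing c with
  | zero =>
    have h : M 0 c = normSqMoment n ρ 0 c := by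
      rw [normSqMoment_zero_left]
      induction c with
      | zero => simpa using h₀
      | succ c ih => rw [hM₀, ih, Finset.prod_range_succ, mul_comm]
    exact ⟨h, by rw [hN, h, innerNormSqMoment_zero_left]; simp⟩
  | succ b ih =>
    have h : M (b + 1) c = normSqMoment n ρ (b + 1) c := by
      rw [hM]
      cases c with
      | zero => simp [(ih 0).1, normSqMoment_succ_zero]
      | succ c => simp [(ih _).1, (ih _).2, normSqMoment_succ_succ]
    exact ⟨h, by simp [hN (b + 1) c, h, innerNormSqMoment_succ, (ih c).2]⟩

/-- Under `i ↦ m - i` the first two products become `Ico 0 a` and `Ico a b`, which join into the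
common factor over `range b`. Terms with `b < a ≤ c` vanish with `b.choose a`. -/
theorem normSqMoment_eq_sum (n ρ : ℝ) (b c : ℕ) :
    normSqMoment n ρ b c = ∑ a ∈ Finset.range (min b c + 1),
      ρ ^ (2 * a) *
        ((2 : ℝ) ^ a * (b ! : ℝ) * (c ! : ℝ) / (((b - a)! : ℝ) * ((c - a)! : ℝ) * (a ! : ℝ))) *
        (∏ i ∈ Finset.Icc 1 a, (n + 2 * ((a : ℝ) - (i : ℝ)))) *
        (∏ i ∈ Finset.Icc 1 (b - a), (n + 2 * ((b : ℝ) - (i : ℝ)))) *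
        (∏ i ∈ Finset.Icc 1 (c - a), (n + 2 * ((c : ℝ) - (i : ℝ)))) := by
  have hprod {a m : ℕ} (ham : a ≤ m) : ∏ i ∈ Finset.Icc 1 (m - a), (n + 2 * ((m : ℝ) - (i : ℝ))) =
      ∏ j ∈ Finset.Ico a m, (n + 2 * (j : ℝ)) := by
    refine Finset.prod_bij' (fun i _ => m - i) (fun j _ => m - j) ?_ ?_ ?_ ?_ ?_
    · simp only [Finset.mem_Icc, Finset.mem_Ico]; lia
    · simp only [Finset.mem_Icc, Finset.mem_Ico]; lia
    · simp only [Finset.mem_Icc]; lia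
    · simp only [Finset.mem_Ico]; lia
    · intro i hi
      rw [Finset.mem_Icc] at hi
      rw [Nat.cast_sub (by lia)]
  rw [normSqMoment, Finset.mul_sum]
  symm
  refine Finset.sum_subset_zero_on_sdiff (by simp) ?_ ?_
  · intro a ha
    simp only [Finset.mem_sdiff, Finset.mem_range] at ha
    simp [Nat.choose_eq_zero_of_lt (show b < a by lia)]
  · intro a ha
    have hab : a ≤ b := by simp at ha; lia
    have hac : a ≤ c := by simp at ha; lia
    have h₀ := hprod (Nat.zero_le a)
    rw [Nat.sub_zero] at h₀
    rw [h₀, hprod hab, hprod hac, mul_assoc (ρ ^ (2 * a) * _), Finset.prod_Ico_consecutive _ (by lia)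
      hab, Finset.range_eq_Ico, Nat.cast_choose ℝ hab, Nat.cast_choose ℝ hac, mul_pow, ← pow_mul]
    field_simp

/-! ### Recursion from abstract integration by parts -/

section Algebraic

variable {A ι : Type*} [CommRing A] [Algebra ℝ A] [Fintype ι] [DecidableEq ι]
  {E : A →ₗ[ℝ] ℝ} {x y : ι → A} {D D' : ι → Derivation ℝ A A} {ρ : ℝ}

theorem derivation_sum_sq (hD : ∀ t s, D t (x s) = if t = s then algebraMap ℝ A ρ else 0) (t : ι) :
    D t (∑ s, x s ^ 2) = algebraMap ℝ A (2 * ρ) * x t := by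
  simp only [map_sum, Derivation.leibniz_pow, hD, smul_eq_mul, mul_ite, mul_zero, nsmul_eq_mul,
    Finset.sum_ite_eq, Finset.mem_univ, if_true, map_mul, map_ofNat, Nat.cast_ofNat,
    Nat.add_one_sub_one, pow_one]
  ring

/-- Integrate by parts in `U^(b+1) V^c = ∑ x_t (x_t U^b V^c)`. Differentiating `x_t`, `U^b`, `V^c`
yields the terms with `card ι`, `2b`, `2cρ` respectively. -/
theorem map_normSq_pow_succ_mul (hE : ∀ t p, E (x t * p) = E (D t p))
    (hx : ∀ t s, D t (x s) = if t = s then 1 else 0)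
    (hy : ∀ t s, D t (y s) = if t = s then algebraMap ℝ A ρ else 0) (b c : ℕ) :
    E ((∑ t, x t ^ 2) ^ (b + 1) * (∑ t, y t ^ 2) ^ c) =
      ((Fintype.card ι : ℝ) + 2 * b) * E ((∑ t, x t ^ 2) ^ b * (∑ t, y t ^ 2) ^ c) +
      2 * c * ρ *
        E ((∑ t, x t * y t) * (∑ t, x t ^ 2) ^ b * (∑ t, y t ^ 2) ^ (c - 1)) := by
  set U := ∑ t, x t ^ 2 with hU
  set V := ∑ t, y t ^ 2 with hV
  have hDU (t : ι) : D t U = 2 * x t := by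
    rw [hU, derivation_sum_sq (ρ := 1) (by simpa using hx), mul_one, map_ofNat]
  have hDV (t : ι) : D t V = algebraMap ℝ A (2 * ρ) * y t := derivation_sum_sq hy t
  have hsum : U ^ (b + 1) * V ^ c = ∑ t, x t * (x t * (U ^ b * V ^ c)) := by
    simp only [← mul_assoc, ← Finset.sum_mul, ← pow_two]
    rw [← hU, pow_succ']
  have hterm (t : ι) : D t (x t * (U ^ b * V ^ c)) = U ^ b * V ^ c +
      x t ^ 2 * (2 * b * U ^ (b - 1) * V ^ c) +
      (x t * y t) * (algebraMap ℝ A (2 * c * ρ) * U ^ b * V ^ (c - 1)) := by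
    simp only [Derivation.leibniz, Derivation.leibniz_pow, hDU, hDV, hx, if_true, smul_eq_mul,
      nsmul_eq_mul, map_mul, map_natCast, map_ofNat]
    ring
  have hb : U * (2 * b * U ^ (b - 1) * V ^ c) = 2 * b * (U ^ b * V ^ c) := by
    cases b with
    | zero => simp
    | succ b => simp only [Nat.add_sub_cancel]; ring
  have htot : ∑ t, D t (x t * (U ^ b * V ^ c)) =
      ((Fintype.card ι : ℝ) + 2 * b) • (U ^ b * V ^ c) +
      (2 * c * ρ) • ((∑ t, x t * y t) * U ^ b * V ^ (c - 1)) := by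
    simp only [hterm, Finset.sum_add_distrib, ← Finset.sum_mul, ← hU, hb, Finset.sum_const,
      Finset.card_univ, nsmul_eq_mul]
    simp only [Algebra.smul_def, map_add, map_mul, map_natCast, map_ofNat]
    ring
  rw [hsum, map_sum]
  simp only [hE]
  rw [← map_sum, htot, map_add, map_smul, map_smul, smul_eq_mul, smul_eq_mul]

/-- The same with `T U^b V^c = ∑ x_t (y_t U^b V^c)`; here `D_t y_t = ρ`. -/
theorem map_inner_mul_normSq_pow (hE : ∀ t p, E (x t * p) = E (D t p))
    (hx : ∀ t s, D t (x s) = if t = s then 1 else 0)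
    (hy : ∀ t s, D t (y s) = if t = s then algebraMap ℝ A ρ else 0) (b c : ℕ) :
    E ((∑ t, x t * y t) * (∑ t, x t ^ 2) ^ b * (∑ t, y t ^ 2) ^ c) =
      2 * b * E ((∑ t, x t * y t) * (∑ t, x t ^ 2) ^ (b - 1) * (∑ t, y t ^ 2) ^ c) +
      ρ * ((Fintype.card ι : ℝ) + 2 * c) * E ((∑ t, x t ^ 2) ^ b * (∑ t, y t ^ 2) ^ c) := by
  set U := ∑ t, x t ^ 2 with hU
  set V := ∑ t, y t ^ 2 with hV
  have hDU (t : ι) : D t U = 2 * x t := by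
    rw [hU, derivation_sum_sq (ρ := 1) (by simpa using hx), mul_one, map_ofNat]
  have hDV (t : ι) : D t V = algebraMap ℝ A (2 * ρ) * y t := derivation_sum_sq hy t
  have hsum : (∑ t, x t * y t) * U ^ b * V ^ c = ∑ t, x t * (y t * (U ^ b * V ^ c)) := by
    simp only [← mul_assoc, ← Finset.sum_mul]
  have hterm (t : ι) : D t (y t * (U ^ b * V ^ c)) = algebraMap ℝ A ρ * (U ^ b * V ^ c) +
      (x t * y t) * (2 * b * U ^ (b - 1) * V ^ c) +
      y t ^ 2 * (algebraMap ℝ A (2 * c * ρ) * U ^ b * V ^ (c - 1)) := by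
    simp only [Derivation.leibniz, Derivation.leibniz_pow, hDU, hDV, hy, if_true, smul_eq_mul,
      nsmul_eq_mul, map_mul, map_natCast, map_ofNat]
    ring
  have hc : V * (algebraMap ℝ A (2 * c * ρ) * U ^ b * V ^ (c - 1)) =
      algebraMap ℝ A (2 * c * ρ) * (U ^ b * V ^ c) := by
    cases c with
    | zero => simp
    | succ c => simp only [Nat.add_sub_cancel]; ring
  have htot : ∑ t, D t (y t * (U ^ b * V ^ c)) =
      (2 * b : ℝ) • ((∑ t, x t * y t) * U ^ (b - 1) * V ^ c) +
      (ρ * ((Fintype.card ι : ℝ) + 2 * c)) • (U ^ b * V ^ c) := by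
    simp only [hterm, Finset.sum_add_distrib, ← Finset.sum_mul, ← hV]
    rw [hc, Finset.sum_const, Finset.card_univ, nsmul_eq_mul]
    simp only [Algebra.smul_def, map_add, map_mul, map_natCast, map_ofNat]
    ring
  rw [hsum, map_sum]
  simp only [hE]
  rw [← map_sum, htot, map_add, map_smul, map_smul, smul_eq_mul, smul_eq_mul]

/-- The moments of the squared norms of two correlated families of standard normal variables, for an
abstract expectation `E` satisfying the Gaussian integration by parts formula. -/
theorem map_normSq_pow_mul_normSq_pow (h₁ : E 1 = 1) (hE : ∀ t p, E (x t * p) = E (D t p))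
    (hE' : ∀ t p, E (y t * p) = E (D' t p))
    (hx : ∀ t s, D t (x s) = if t = s then 1 else 0)
    (hy : ∀ t s, D t (y s) = if t = s then algebraMap ℝ A ρ else 0)
    (hx' : ∀ t s, D' t (x s) = if t = s then algebraMap ℝ A ρ else 0)
    (hy' : ∀ t s, D' t (y s) = if t = s then 1 else 0) (b c : ℕ) :
    E ((∑ t, x t ^ 2) ^ b * (∑ t, y t ^ 2) ^ c) = normSqMoment (Fintype.card ι) ρ b c := by
  refine (eq_normSqMoment_of_recursion
    (M := fun b c => E ((∑ t, x t ^ 2) ^ b * (∑ t, y t ^ 2) ^ c))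
    (N := fun b c => E ((∑ t, x t * y t) * (∑ t, x t ^ 2) ^ b * (∑ t, y t ^ 2) ^ c))
    (by simpa using h₁) (fun c => ?_) (fun b c => map_normSq_pow_succ_mul hE hx hy b c)
    (fun b c => map_inner_mul_normSq_pow hE hx hy b c) b c).1
  -- The pure powers of `V` need integration by parts in `y`, with the roles of `x` and `y`
  -- exchanged.
  simpa using map_normSq_pow_succ_mul hE' hy' hx' c 0

end Algebraic

/-! ### Moments of one standard normal variable -/

theorem integrable_pow_gaussianReal (n : ℕ) : Integrable (fun z : ℝ => z ^ n) (gaussianReal 0 1) := by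
  have h := (memLp_id_gaussianReal (μ := 0) (v := 1) n).integrable_norm_pow'
  exact (integrable_norm_iff (by fun_prop)).1 (by simpa [norm_pow] using h)

theorem integrable_pow_mul_gaussianPDFReal (n : ℕ) :
    Integrable (fun z : ℝ => z ^ n * gaussianPDFReal 0 1 z) := by
  have h := integrable_pow_gaussianReal n
  rw [gaussianReal_of_var_ne_zero _ one_ne_zero,
    integrable_withDensity_iff (measurable_gaussianPDF _ _) (by simp [gaussianPDF])] at h
  simpa [gaussianPDF, gaussianPDFReal_nonneg] using h

theorem hasDerivAt_gaussianPDFReal_zero_one (z : ℝ) :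
    HasDerivAt (gaussianPDFReal 0 1) (-z * gaussianPDFReal 0 1 z) z := by
  rw [gaussianPDFReal_def]
  have h : HasDerivAt (fun z : ℝ => -(z - 0) ^ 2 / (2 * ((1 : NNReal) : ℝ))) (-z) z := by
    have := (((hasDerivAt_id z).sub_const 0).pow 2).neg.div_const (2 * ((1 : NNReal) : ℝ))
    refine this.congr_deriv ?_
    simp
    ring
  refine (h.exp.const_mul _).congr_deriv ?_
  ring

/-- Integration by parts with `φ' = -zφ` for the density `φ`. -/
theorem integral_pow_succ_gaussianReal (n : ℕ) :
    ∫ z, z ^ (n + 1) ∂gaussianReal 0 1 = n * ∫ z, z ^ (n - 1) ∂gaussianReal 0 1 := by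
  simp only [integral_gaussianReal_eq_integral_smul one_ne_zero, smul_eq_mul]
  have h := integral_mul_deriv_eq_deriv_mul_of_integrable (u := fun z : ℝ => z ^ n)
    (u' := fun z => n * z ^ (n - 1)) (v := gaussianPDFReal 0 1)
    (v' := fun z => -z * gaussianPDFReal 0 1 z) (fun z _ => hasDerivAt_pow n z)
    (fun z _ => hasDerivAt_gaussianPDFReal_zero_one z)
    (by
      refine (integrable_pow_mul_gaussianPDFReal (n + 1)).neg.congr (.of_forall fun z => ?_)
      simp only [Pi.neg_apply, Pi.mul_apply]; ring)
    (by
      refine ((integrable_pow_mul_gaussianPDFReal (n - 1)).const_mul n).congr (.of_forall fun z => ?_)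
      simp only [Pi.mul_apply]; ring)
    (integrable_pow_mul_gaussianPDFReal n)
  calc ∫ z, gaussianPDFReal 0 1 z * z ^ (n + 1)
      = -∫ z, z ^ n * (-z * gaussianPDFReal 0 1 z) := by
        rw [← integral_neg]
        exact integral_congr_ae (.of_forall fun z => by ring)
    _ = ∫ z, n * z ^ (n - 1) * gaussianPDFReal 0 1 z := by rw [h, neg_neg]
    _ = n * ∫ z, gaussianPDFReal 0 1 z * z ^ (n - 1) := by
        rw [← integral_const_mul]
        exact integral_congr_ae (.of_forall fun z => by ring)

/-! ### Polynomials in independent standard normals -/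

section GaussianArray

variable {ι κ : Type*} [Fintype ι] [Fintype κ]

/-- The law of an array of independent standard normal variables. -/
noncomputable def gaussianArray (ι κ : Type*) [Fintype ι] [Fintype κ] : Measure (ι → κ → ℝ) :=
  Measure.pi fun _ => Measure.pi fun _ => gaussianReal 0 1

instance : IsProbabilityMeasure (gaussianArray ι κ) := by
  unfold gaussianArray; infer_instance

theorem eval_monomial_array (m : ι × κ →₀ ℕ) (a : ℝ) (z : ι → κ → ℝ) :
    MvPolynomial.eval (fun k => z k.1 k.2) (MvPolynomial.monomial m a) =
      a * ∏ i, ∏ j, z i j ^ m (i, j) := by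
  rw [MvPolynomial.eval_monomial, Finsupp.prod_fintype _ _ (by simp), Fintype.prod_prod_type]

theorem integrable_eval_gaussianArray (p : MvPolynomial (ι × κ) ℝ) :
    Integrable (fun z : ι → κ → ℝ => MvPolynomial.eval (fun k => z k.1 k.2) p)
      (gaussianArray ι κ) := by
  induction p using MvPolynomial.induction_on' with
  | monomial m a =>
    simp only [eval_monomial_array]
    exact (Integrable.fintype_prod_dep (f := fun i (w : κ → ℝ) => ∏ j, w j ^ m (i, j)) fun i =>
      Integrable.fintype_prod (f := fun j (w : ℝ) => w ^ m (i, j)) fun j =>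
        integrable_pow_gaussianReal _).const_mul a
  | add p q hp hq =>
    simp only [map_add]
    exact hp.add hq

/-- The expectation of a polynomial in independent standard normal variables. -/
noncomputable def gaussianExpectation (ι κ : Type*) [Fintype ι] [Fintype κ] :
    MvPolynomial (ι × κ) ℝ →ₗ[ℝ] ℝ where
  toFun p := ∫ z, MvPolynomial.eval (fun k => z k.1 k.2) p ∂gaussianArray ι κ
  map_add' p q := by
    simp only [map_add]
    exact integral_add (integrable_eval_gaussianArray p) (integrable_eval_gaussianArray q)
  map_smul' a p := by simp [MvPolynomial.smul_eval, integral_const_mul]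

theorem gaussianExpectation_monomial (m : ι × κ →₀ ℕ) (a : ℝ) :
    gaussianExpectation ι κ (MvPolynomial.monomial m a) =
      a * ∏ k, ∫ z, z ^ m k ∂gaussianReal 0 1 := by
  change ∫ z : ι → κ → ℝ, MvPolynomial.eval (fun k : ι × κ => z k.1 k.2) _
    ∂gaussianArray ι κ = _
  simp only [eval_monomial_array, integral_const_mul, gaussianArray]
  rw [integral_fintype_prod_eq_prod (fun i (w : κ → ℝ) => ∏ j, w j ^ m (i, j)),
    Fintype.prod_prod_type]
  congr! with i
  exact integral_fintype_prod_eq_prod (fun j (w : ℝ) => w ^ m (i, j))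

/-- Gaussian integration by parts for polynomials. -/
theorem gaussianExpectation_X_mul (k : ι × κ) (p : MvPolynomial (ι × κ) ℝ) :
    gaussianExpectation ι κ (MvPolynomial.X k * p) =
      gaussianExpectation ι κ (MvPolynomial.pderiv k p) := by
  classical
  induction p using MvPolynomial.induction_on' with
  | monomial m a =>
    rw [MvPolynomial.pderiv_monomial, MvPolynomial.X, MvPolynomial.monomial_mul,
      gaussianExpectation_monomial, gaussianExpectation_monomial,
      ← Finset.mul_prod_erase _ _ (Finset.mem_univ k),
      ← Finset.mul_prod_erase _ _ (Finset.mem_univ k)]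
    have h : ∏ l ∈ Finset.univ.erase k,
          ∫ z, z ^ ((Finsupp.single k 1 + m : ι × κ →₀ ℕ) l) ∂gaussianReal 0 1 =
        ∏ l ∈ Finset.univ.erase k,
          ∫ z, z ^ ((m - Finsupp.single k 1 : ι × κ →₀ ℕ) l) ∂gaussianReal 0 1 := by
      refine Finset.prod_congr rfl fun l hl => ?_
      have hl : k ≠ l := (Finset.ne_of_mem_erase hl).symm
      simp [Finsupp.single_eq_of_ne' hl]
    rw [h]
    -- If `m k = 0`, the truncated exponent is harmless: both sides carry the factor `m k`.
    simp only [Finsupp.add_apply, Finsupp.tsub_apply, Finsupp.single_eq_same, add_comm 1 (m k),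
      integral_pow_succ_gaussianReal]
    ring
  | add p q hp hq => simp only [mul_add, map_add, hp, hq]

/-- The linear form `∑ⱼ R i j z t j` in the array `z`. -/
noncomputable def arrayForm (R : Matrix κ κ ℝ) (t : ι) (i : κ) : MvPolynomial (ι × κ) ℝ :=
  ∑ j, MvPolynomial.C (R i j) * MvPolynomial.X (t, j)

/-- The derivative `∑ⱼ R i j ∂_{t, j}`. -/
noncomputable def arrayDeriv (R : Matrix κ κ ℝ) (t : ι) (i : κ) :
    Derivation ℝ (MvPolynomial (ι × κ) ℝ) (MvPolynomial (ι × κ) ℝ) :=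
  ∑ j, R i j • MvPolynomial.pderiv (t, j)

omit [Fintype ι] in
theorem arrayDeriv_apply (R : Matrix κ κ ℝ) (t : ι) (i : κ) (p : MvPolynomial (ι × κ) ℝ) :
    arrayDeriv R t i p = ∑ j, R i j • MvPolynomial.pderiv (t, j) p := by
  simp only [arrayDeriv, ← Derivation.coeFnAddMonoidHom_apply, map_sum, Finset.sum_apply]
  rfl

omit [Fintype ι] in
theorem eval_arrayForm (R : Matrix κ κ ℝ) (t : ι) (i : κ) (z : ι → κ → ℝ) :
    MvPolynomial.eval (fun k => z k.1 k.2) (arrayForm R t i) = (R *ᵥ z t) i := by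
  simp [arrayForm, Matrix.mulVec, dotProduct]

theorem gaussianExpectation_arrayForm_mul (R : Matrix κ κ ℝ) (t : ι) (i : κ)
    (p : MvPolynomial (ι × κ) ℝ) :
    gaussianExpectation ι κ (arrayForm R t i * p) =
      gaussianExpectation ι κ (arrayDeriv R t i p) := by
  simp only [arrayForm, arrayDeriv_apply, Finset.sum_mul, map_sum, ← MvPolynomial.smul_eq_C_mul,
    smul_mul_assoc, map_smul, gaussianExpectation_X_mul]

-- Derivatives of the forms reproduce their covariances, so only `R * Rᵀ` enters the recursion.
omit [Fintype ι] in
theorem arrayDeriv_arrayForm [DecidableEq ι] (R : Matrix κ κ ℝ) (t s : ι) (i j : κ) :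
    arrayDeriv R t i (arrayForm R s j) = if t = s then MvPolynomial.C ((R * Rᵀ) i j) else 0 := by
  classical
  simp only [arrayDeriv_apply, arrayForm, map_sum, MvPolynomial.pderiv_C_mul, MvPolynomial.pderiv_X,
    Pi.single_apply, Prod.mk.injEq]
  split_ifs with h
  · simp [h, Matrix.mul_apply, MvPolynomial.smul_eq_C_mul]
  · simp [Ne.symm h]

end GaussianArray

/-! ### Wishart and Kibble laws as images of a Gaussian array -/

-- The positive semidefinite square root serves as `R`; singular `S`, hence `|ρ| = 1`, is covered.
open scoped MatrixOrder in
theorem exists_multivariateGaussian_eq_map {κ : Type*} [Fintype κ] [DecidableEq κ]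
    {S : Matrix κ κ ℝ} (hS : S.PosSemidef) :
    ∃ R : Matrix κ κ ℝ, R * Rᵀ = S ∧ multivariateGaussian 0 S =
      (Measure.pi fun _ : κ => gaussianReal 0 1).map fun z => WithLp.toLp 2 (R *ᵥ z) := by
  refine ⟨CFC.sqrt S, ?_, ?_⟩
  · have h : (CFC.sqrt S)ᵀ = CFC.sqrt S := by
      have := (CFC.sqrt_nonneg S).isSelfAdjoint.star_eq
      rwa [Matrix.star_eq_conjTranspose, Matrix.conjTranspose_eq_transpose_of_trivial] at this
    rw [h, CFC.sqrt_mul_sqrt_self _ hS.nonneg]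
  · rw [multivariateGaussian, ← map_pi_eq_stdGaussian, Measure.map_map (by fun_prop) (by fun_prop)]
    congr 1
    ext z i
    simp

theorem exists_wishart_eq_map {p : ℕ} (ν : ℕ) {S : Matrix (Fin p) (Fin p) ℝ} (hS : S.PosSemidef) :
    ∃ R : Matrix (Fin p) (Fin p) ℝ, R * Rᵀ = S ∧ wishart p ν S =
      (gaussianArray (Fin ν) (Fin p)).map
        fun z => scatterMatrix fun t => WithLp.toLp 2 (R *ᵥ z t) := by
  obtain ⟨R, hR, h⟩ := exists_multivariateGaussian_eq_map hS
  refine ⟨R, hR, ?_⟩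
  have hf : Measurable fun z : Fin p → ℝ => WithLp.toLp 2 (R *ᵥ z) := by fun_prop
  have : IsProbabilityMeasure ((Measure.pi fun _ : Fin p => gaussianReal 0 1).map
      fun z => WithLp.toLp 2 (R *ᵥ z)) := Measure.isProbabilityMeasure_map hf.aemeasurable
  rw [wishart, h, ← Measure.pi_map_pi fun _ => hf.aemeasurable,
    Measure.map_map measurable_scatterMatrix (by fun_prop)]
  rfl

theorem posSemidef_correlation {ρ : ℝ} (hρ : |ρ| ≤ 1) : (!![1, ρ; ρ, 1]).PosSemidef := by
  refine .of_dotProduct_mulVec_nonneg ?_ fun x => ?_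
  · ext i j
    fin_cases i <;> fin_cases j <;> simp
  · have h := abs_le.1 hρ
    simp [Matrix.mulVec, dotProduct, Fin.sum_univ_two]
    -- Twice the quadratic form is `(1-ρ)(x₀-x₁)² + (1+ρ)(x₀+x₁)²`.
    nlinarith [mul_nonneg (sub_nonneg.2 h.2) (sq_nonneg (x 0 - x 1)),
      mul_nonneg (neg_le_iff_add_nonneg.1 h.1) (sq_nonneg (x 0 + x 1))]

theorem moment_kibble (ν : ℕ) {ρ : ℝ} (hρ : |ρ| ≤ 1) (b c : ℕ) :
    Integrable (fun w : ℝ × ℝ => w.1 ^ b * w.2 ^ c) (kibble ν ρ) ∧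
      ∫ w, w.1 ^ b * w.2 ^ c ∂kibble ν ρ = normSqMoment ν ρ b c := by
  obtain ⟨R, hR, h⟩ := exists_wishart_eq_map ν (posSemidef_correlation hρ)
  have hscatter : Measurable fun z : Fin ν → Fin 2 → ℝ =>
      scatterMatrix fun t => WithLp.toLp 2 (R *ᵥ z t) :=
    measurable_scatterMatrix.comp (by fun_prop)
  have hdiag : Measurable fun W : Matrix (Fin 2) (Fin 2) ℝ => (W 0 0, W 1 1) :=
    Measurable.prodMk ((measurable_pi_apply 0).comp (measurable_pi_apply 0))
      ((measurable_pi_apply 1).comp (measurable_pi_apply 1))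
  have hmeas : AEStronglyMeasurable (fun w : ℝ × ℝ => w.1 ^ b * w.2 ^ c) (kibble ν ρ) :=
    Measurable.aestronglyMeasurable (by fun_prop)
  rw [kibble, h, Measure.map_map hdiag hscatter] at hmeas ⊢
  have heval (z : Fin ν → Fin 2 → ℝ) :
      ((fun W : Matrix (Fin 2) (Fin 2) ℝ => (W 0 0, W 1 1)) ∘
        fun z : Fin ν → Fin 2 → ℝ => scatterMatrix fun t => WithLp.toLp 2 (R *ᵥ z t)) z =
      (MvPolynomial.eval (fun k => z k.1 k.2) (∑ t, arrayForm R t 0 ^ 2),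
        MvPolynomial.eval (fun k => z k.1 k.2) (∑ t, arrayForm R t 1 ^ 2)) := by
    simp only [map_sum, map_pow, eval_arrayForm]
    simp [scatterMatrix, pow_two]
  have hcomp (z : Fin ν → Fin 2 → ℝ) := congrArg (fun w : ℝ × ℝ => w.1 ^ b * w.2 ^ c) (heval z)
  simp only [← map_pow, ← map_mul] at hcomp
  constructor
  · rw [integrable_map_measure hmeas (hdiag.comp hscatter).aemeasurable]
    exact (integrable_eval_gaussianArray _).congr (.of_forall fun z => (hcomp z).symm)
  · rw [integral_map (hdiag.comp hscatter).aemeasurable hmeas, integral_congr_ae (.of_forall hcomp)]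
    -- The integrand is now a polynomial in the array, so the algebraic recursion applies.
    change gaussianExpectation (Fin ν) (Fin 2) _ = _
    have hδ (t s : Fin ν) (i j : Fin 2) : arrayDeriv R t i (arrayForm R s j) =
        if t = s then MvPolynomial.C (!![1, ρ; ρ, 1] i j) else 0 := by
      rw [arrayDeriv_arrayForm, hR]
    rw [map_normSq_pow_mul_normSq_pow (D := fun t => arrayDeriv R t 0)
      (D' := fun t => arrayDeriv R t 1) (ρ := ρ) ?_
      (fun t => gaussianExpectation_arrayForm_mul R t 0)
      (fun t => gaussianExpectation_arrayForm_mul R t 1), Fintype.card_fin]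
    · intro t s; simp [hδ]
    · intro t s; simp [hδ, MvPolynomial.algebraMap_eq]
    · intro t s; simp [hδ, MvPolynomial.algebraMap_eq]
    · intro t s; simp [hδ]
    · rw [← MvPolynomial.C_1, MvPolynomial.C_apply, gaussianExpectation_monomial]
      simp

theorem theorem3 {Ω : Type*} [MeasurableSpace Ω] (P : Measure Ω) (ν : ℕ) (ρ : ℝ) (hρ : |ρ| ≤ 1)
    (w₁₁ w₂₂ : Ω → ℝ) (hw : HasLaw (fun ω => (w₁₁ ω, w₂₂ ω)) (kibble ν ρ) P) (b c : ℕ) :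
    Integrable (fun ω => w₁₁ ω ^ b * w₂₂ ω ^ c) P ∧
    ∫ ω, w₁₁ ω ^ b * w₂₂ ω ^ c ∂P =
      ∑ a ∈ Finset.range (min b c + 1),
        ρ ^ (2 * a) *
          ((2 : ℝ) ^ a * (b ! : ℝ) * (c ! : ℝ) / (((b - a)! : ℝ) * ((c - a)! : ℝ) * (a ! : ℝ))) *
          (∏ i ∈ Finset.Icc 1 a, ((ν : ℝ) + 2 * ((a : ℝ) - (i : ℝ)))) *
          (∏ i ∈ Finset.Icc 1 (b - a), ((ν : ℝ) + 2 * ((b : ℝ) - (i : ℝ)))) *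
          (∏ i ∈ Finset.Icc 1 (c - a), ((ν : ℝ) + 2 * ((c : ℝ) - (i : ℝ)))) := by
  have hmeas : AEStronglyMeasurable (fun w : ℝ × ℝ => w.1 ^ b * w.2 ^ c)
      (P.map fun ω => (w₁₁ ω, w₂₂ ω)) := Measurable.aestronglyMeasurable (by fun_prop)
  obtain ⟨hint, hval⟩ := moment_kibble ν hρ b c
  rw [← hw.map_eq] at hint hval
  refine ⟨(integrable_map_measure hmeas hw.aemeasurable).1 hint, ?_⟩
  rw [integral_map hw.aemeasurable hmeas] at hval
  rw [hval, normSqMoment_eq_sum]
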